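/- Let $m,n$ be positive even integers. Let $T_{m,n}$ be the toroidal square grid with node set $V_{m,n}=\{0,\dots,m-1\}\times\{0,\dots,n-1\}$ (coordinates modulo $m$ and $n$): for each node $(i,j)$ there is one vertical edge joining $(i,j)$ to $(i+1,j)$ and one horizontal edge joining $(i,j)$ to $(i,j+1)$ (so a cycle of length $2$ consists of two parallel edges). Let $A$ be the set of the $n$ vertical edges joining row $m-1$ to row $0$, i.e. $(m-1,j)$ to $(0,j)$, and $B$ the set of the $m$ horizontal edges joining column $n-1$ to column $0$, i.e. $(i,n-1)$ to $(i,0)$. A node $(i,j)$ is black if $i+j$ is even and white otherwise. A set $S$ of edges has type $EE$, $EO$, $OE$ or $OO$ according to the parities (E = even, O = odd) of $|S\cap A|$ and $|S\cap B|$, in this order. For a perfect matching $M$ of $T_{m,n}$, let $D_{m,n}(M)$ be the digraph on $V_{m,n}$ whose arcs are the following orientations of edges of $T_{m,n}$: an edge at a black node $v$ is directed out of $v$ if and only if it belongs to $M$; an edge from a white node $v$ to a node $w$ is directed out of $v$ if and only if it does not belong to $M$ and $u,v,w$ all lie in one row or all lie in one column, where $u$ is the node matched to $v$ by $M$. For a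 dicycle $C$ let $U(C)$ be its set of edges without orientation; $C$ has type $ee$, $eo$, $oe$ or $oo$ if $U(C)$ has type $EE$, $EO$, $OE$ or $OO$, respectively. Fix any total order on the subsets of $V_{m,n}$, and compare dicycles through their node sets. Then for every perfect matching $M$ of $T_{m,n}$ the digraph $D_{m,n}(M)$ has a unique first dicycle $C_M$, and $\Phi_{m,n}(M)=M\,\triangle\,U(C_M)$ is again a perfect matching of $T_{m,n}$. Moreover: (i) If a perfect matching $M$ of $T_{m,n}$ is of type $EO$, $OE$ or $OO$, then $C_M$ is of type $eo$, $oe$ or $oo$, respectively. (ii) The image under $\Phi_{m,n}$ of the set of perfect matchings of type $EO$, $OE$ or $OO$ is exactly the set of perfect matchings of type $EE$. -/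

import Mathlib

namespace TorusGrid

/-- The node set `{0, …, m-1} × {0, …, n-1}`, with arithmetic modulo `m` in the first coordinate
(the row index) and modulo `n` in the second coordinate (the column index). -/
abbrev Node (m n : ℕ) : Type := ZMod m × ZMod n

/-- The edges of the toroidal grid. `vert (i, j)` joins `(i, j)` to `(i + 1, j)` and
`horiz (i, j)` joins `(i, j)` to `(i, j + 1)`. -/
inductive Edge (m n : ℕ) : Type
  | vert (p : Node m n) : Edge m n
  | horiz (p : Node m n) : Edge m n

/-- The two ends of an edge. -/
def Edge.ends {m n : ℕ} : Edge m n → Node m n × Node m n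
  | .vert p => (p, (p.1 + 1, p.2))
  | .horiz p => (p, (p.1, p.2 + 1))

/-- The toroidal square grid `T_{m,n}`, made of `m` horizontal cycles of length `n` and `n`
vertical cycles of length `m`. A cycle of length `2` consists of two parallel edges; if
`m, n ≥ 3` this is a simple graph. -/
def grid (m n : ℕ) : Graph (Node m n) (Edge m n) where
  vertexSet := Set.univ
  IsLink e u v := e.ends = (u, v) ∨ e.ends = (v, u)
  isLink_symm _ _ := ⟨fun _ _ h => h.symm⟩
  eq_or_eq_of_isLink_of_isLink := by
    rintro e x y v w (h | h) (h' | h') <;> rw [h] at h' <;> simp only [Prod.mk.injEq] at h' <;>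
      tauto
  left_mem_of_isLink := fun _ _ _ _ => Set.mem_univ _

/-- A perfect matching: a set of edges such that each node is an end of exactly one of them. -/
def IsPerfectMatching {m n : ℕ} (M : Set (Edge m n)) : Prop :=
  ∀ v : Node m n, ∃! e, e ∈ M ∧ (grid m n).Inc e v

/-- The black nodes `(i, j)`, those with `i + j` even; the other nodes are white. -/
def IsBlack {m n : ℕ} (v : Node m n) : Prop := Even (v.1.val + v.2.val)

/-- The nodes `u`, `v`, `w` all lie in the same row or all lie in the same column. -/
def Aligned {m n : ℕ} (u v w : Node m n) : Prop :=
  (u.1 = v.1 ∧ v.1 = w.1) ∨ (u.2 = v.2 ∧ v.2 = w.2)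

/-- An edge directed from `tail` to `head`. -/
@[ext]
structure Arc (m n : ℕ) : Type where
  edge : Edge m n
  tail : Node m n
  head : Node m n

/-- The set of arcs of the digraph `D_{m,n}(M)` on the nodes of the grid. An edge that leaves a
black node is the matching edge there. An edge that leaves a white node `v` is a non-matching edge
to a node `w` such that `u`, `v`, `w` are aligned, where `uv` is the matching edge at `v`. -/
def digraph {m n : ℕ} (M : Set (Edge m n)) : Set (Arc m n) :=
  {a | (grid m n).IsLink a.edge a.tail a.head ∧
    (IsBlack a.tail → a.edge ∈ M) ∧
    (¬ IsBlack a.tail → a.edge ∉ M ∧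
      ∀ e ∈ M, ∀ u, (grid m n).IsLink e u a.tail → Aligned u a.tail a.head)}

/-- A dicycle, given by its set of arcs: a closed cyclic sequence of `k ≥ 1` arcs that visits no
node twice. -/
def IsDicycle {m n : ℕ} (C : Set (Arc m n)) : Prop :=
  ∃ k : ℕ, 0 < k ∧ ∃ a : ZMod k → Arc m n,
    Function.Injective (fun i => (a i).tail) ∧
    (∀ i, (a i).head = (a (i + 1)).tail) ∧
    Set.range a = C

/-- The node set of a dicycle. -/
def nodes {m n : ℕ} (C : Set (Arc m n)) : Set (Node m n) := Arc.tail '' C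

/-- `U(C)`: the edges of `C`, ignoring orientations. -/
def U {m n : ℕ} (C : Set (Arc m n)) : Set (Edge m n) := Arc.edge '' C

/-- `C` is a first dicycle of `D_{m,n}(M)`, where dicycles are compared through their node sets
by the order `r`. -/
def IsFirstDicycle {m n : ℕ} (r : Set (Node m n) → Set (Node m n) → Prop)
    (M : Set (Edge m n)) (C : Set (Arc m n)) : Prop :=
  (IsDicycle C ∧ C ⊆ digraph M) ∧
    ∀ C', IsDicycle C' → C' ⊆ digraph M → r (nodes C) (nodes C')

open Classical in
/-- `C_M`: the first dicycle of `D_{m,n}(M)` (the empty set if there were none). -/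
noncomputable def firstDicycle {m n : ℕ} (r : Set (Node m n) → Set (Node m n) → Prop)
    (M : Set (Edge m n)) : Set (Arc m n) :=
  if h : ∃ C, IsFirstDicycle r M C then h.choose else ∅

/-- `Φ_{m,n}(M) = M ∆ U(C_M)`. -/
noncomputable def Phi {m n : ℕ} (r : Set (Node m n) → Set (Node m n) → Prop)
    (M : Set (Edge m n)) : Set (Edge m n) :=
  symmDiff M (U (firstDicycle r M))

/-- The layer of vertical edges between row `m - 1` and row `0`. -/
def A (m n : ℕ) : Set (Edge m n) := {e | ∃ j, e = .vert (-1, j)}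

/-- The layer of horizontal edges between column `n - 1` and column `0`. -/
def B (m n : ℕ) : Set (Edge m n) := {e | ∃ i, e = .horiz (i, -1)}

/-- Type `EE` (`ee` for the edge set of a dicycle). -/
def TypeEE {m n : ℕ} (S : Set (Edge m n)) : Prop :=
  Even (S ∩ A m n).ncard ∧ Even (S ∩ B m n).ncard

/-- Type `EO` (`eo` for the edge set of a dicycle). -/
def TypeEO {m n : ℕ} (S : Set (Edge m n)) : Prop :=
  Even (S ∩ A m n).ncard ∧ Odd (S ∩ B m n).ncard

/-- Type `OE` (`oe` for the edge set of a dicycle). -/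
def TypeOE {m n : ℕ} (S : Set (Edge m n)) : Prop :=
  Odd (S ∩ A m n).ncard ∧ Even (S ∩ B m n).ncard

/-- Type `OO` (`oo` for the edge set of a dicycle). -/
def TypeOO {m n : ℕ} (S : Set (Edge m n)) : Prop :=
  Odd (S ∩ A m n).ncard ∧ Odd (S ∩ B m n).ncard

end TorusGrid

namespace TorusGrid

/-! In `D(M)` exactly one arc leaves each node: a black node leaves along its matching edge, a white
node goes straight on, away from its partner. So the dicycles are the periodic orbits of a self-map
of a finite set; two of them are equal or disjoint, and the node set determines the dicycle. Along a
dicycle `C` the edges alternate between `M` and its complement, so flipping `C` gives a perfect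
matching `M'`. In `D(M')` the cycle `C` is reversed, and nodes off `C` keep their arcs, so both
digraphs have the same node sets of dicycles. Hence the reverse of `C_M` is first again and `Phi` is
an involution.

Let `a`, `b` be the parities of `M` on the layers `A`, `B`. Then `parity M = ab + a + b` vanishes
exactly for type `EE`, and everything follows from `IsOrbit.parity_symmDiff`: flipping any dicycle
changes `parity` by 1. Thus `Phi` exchanges `EE` with the other types, and if `M` is not `EE` then
`M` and `U(C_M)` have equal parities on both layers, as their sum is even on both.

The flip law is a sign count in the style of Kasteleyn. Order the nodes lexicographically and draw
matching edges as arcs over a line. Read off the grid, the number of crossings is, modulo 2, the sum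
of the columns of the vertical edges plus `ab` (`sum_halfCross`). Read off the order, it is the
number of inversions of the map from black nodes to their partners, plus terms independent of `M`,
plus the directions of the matching edges and `a + b`. Comparing gives `exists_inversions_eq`.
Flipping a dicycle of length `2(l+1)` composes the partner map with an `(l+1)`-cycle, of sign
`(-1)^l`. As the dicycle goes straight through its white nodes, each of its `l+1` matching edges is
traded for one on the same line with opposite direction. So `parity` changes by `l + (l+1) = 1`. -/

/-- The four directions in the grid. -/
inductive Dir : Type
  | up | down | right | left

/-- The opposite direction. -/
def Dir.opp : Dir → Dir
  | .up => .down
  | .down => .up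
  | .right => .left
  | .left => .right

@[simp] theorem Dir.opp_opp (d : Dir) : d.opp.opp = d := by cases d <;> rfl

theorem Dir.opp_ne (d : Dir) : d.opp ≠ d := by cases d <;> simp [Dir.opp]

/-! ### Directions, and out-degree one in the digraph. -/

section Local

variable {m n : ℕ}

/-- The edge that leaves the node `v` in direction `d`. -/
def edgeAt (v : Node m n) : Dir → Edge m n
  | .up => .vert v
  | .down => .vert (v.1 - 1, v.2)
  | .right => .horiz v
  | .left => .horiz (v.1, v.2 - 1)

/-- The neighbour of the node `v` in direction `d`. -/
def nbr (v : Node m n) : Dir → Node m n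
  | .up => (v.1 + 1, v.2)
  | .down => (v.1 - 1, v.2)
  | .right => (v.1, v.2 + 1)
  | .left => (v.1, v.2 - 1)

@[simp] theorem nbr_nbr_opp (v : Node m n) (d : Dir) : nbr (nbr v d) d.opp = v := by
  cases d <;> simp [nbr, Dir.opp]

@[simp] theorem edgeAt_nbr_opp (v : Node m n) (d : Dir) :
    edgeAt (nbr v d) d.opp = edgeAt v d := by
  cases d <;> simp [nbr, Dir.opp, edgeAt]

theorem isLink_iff (e : Edge m n) (u v : Node m n) :
    (grid m n).IsLink e u v ↔ ∃ d, e = edgeAt u d ∧ v = nbr u d := by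
  constructor
  · rintro (h | h)
    · cases e with
      | vert p =>
        simp only [Edge.ends, Prod.mk.injEq] at h
        exact ⟨.up, by simp [edgeAt, nbr, ← h.1, ← h.2]⟩
      | horiz p =>
        simp only [Edge.ends, Prod.mk.injEq] at h
        exact ⟨.right, by simp [edgeAt, nbr, ← h.1, ← h.2]⟩
    · cases e with
      | vert p =>
        simp only [Edge.ends, Prod.mk.injEq] at h
        exact ⟨.down, by simp [edgeAt, nbr, ← h.1, ← h.2]⟩
      | horiz p =>
        simp only [Edge.ends, Prod.mk.injEq] at h
        exact ⟨.left, by simp [edgeAt, nbr, ← h.1, ← h.2]⟩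
  · rintro ⟨d, rfl, rfl⟩
    cases d <;> simp [grid, edgeAt, nbr, Edge.ends]

theorem inc_iff (e : Edge m n) (v : Node m n) :
    (grid m n).Inc e v ↔ ∃ d, e = edgeAt v d := by
  constructor
  · rintro ⟨w, hw⟩
    obtain ⟨d, hd, -⟩ := (isLink_iff _ _ _).1 hw
    exact ⟨d, hd⟩
  · rintro ⟨d, hd⟩
    exact ⟨nbr v d, (isLink_iff _ _ _).2 ⟨d, hd, rfl⟩⟩

/-- The arc that leaves `v` in direction `d`. -/
def arcAt (v : Node m n) (d : Dir) : Arc m n := ⟨edgeAt v d, v, nbr v d⟩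

open Classical in
/-- The direction of the matching edge at a node. -/
noncomputable def matchDir (M : Set (Edge m n)) (v : Node m n) : Dir :=
  if h : ∃ d, edgeAt v d ∈ M then h.choose else .up

open Classical in
/-- The direction of the unique arc of `D(M)` that leaves a node. -/
noncomputable def outDir (M : Set (Edge m n)) (v : Node m n) : Dir :=
  if IsBlack v then matchDir M v else (matchDir M v).opp

theorem outDir_black {M : Set (Edge m n)} {v : Node m n} (h : IsBlack v) :
    outDir M v = matchDir M v := if_pos h

theorem outDir_white {M : Set (Edge m n)} {v : Node m n} (h : ¬ IsBlack v) :
    outDir M v = (matchDir M v).opp := if_neg h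

theorem isBlack_iff (v : Node m n) :
    IsBlack v ↔ (v.1.val : ZMod 2) + (v.2.val : ZMod 2) = 0 := by
  rw [IsBlack, ← Nat.cast_add, ZMod.natCast_eq_zero_iff_even]

end Local

section Nontrivial

variable {m n : ℕ} [Nontrivial (ZMod m)] [Nontrivial (ZMod n)]

omit [Nontrivial (ZMod n)] in
theorem ne_sub_one (a : ZMod m) : a ≠ a - 1 :=
  fun h => one_ne_zero (sub_eq_self.1 h.symm)

/-- In a cycle of length 2 opposite directions lead to the same node, so parallel edges are told
apart by direction and not by neighbour. -/
theorem edgeAt_injective (v : Node m n) : Function.Injective (edgeAt v) := by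
  intro d d' h
  cases d <;> cases d' <;> simp [edgeAt, Prod.ext_iff, ne_sub_one] at h ⊢

theorem eq_or_eq_of_edgeAt_eq {u v : Node m n} {d d' : Dir} (h : edgeAt u d = edgeAt v d') :
    (u = v ∧ d = d') ∨ (u = nbr v d' ∧ d = d'.opp) := by
  have h1 : (grid m n).IsLink (edgeAt u d) u (nbr u d) := (isLink_iff _ _ _).2 ⟨d, rfl, rfl⟩
  have h2 : (grid m n).IsLink (edgeAt u d) v (nbr v d') := (isLink_iff _ _ _).2 ⟨d', h, rfl⟩
  rcases h1.left_eq_or_eq h2 with rfl | rfl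
  · exact Or.inl ⟨rfl, edgeAt_injective _ h⟩
  · refine Or.inr ⟨rfl, edgeAt_injective (nbr v d') ?_⟩
    rw [h, edgeAt_nbr_opp]

theorem isPerfectMatching_iff (M : Set (Edge m n)) :
    IsPerfectMatching M ↔ ∀ v, ∃! d, edgeAt v d ∈ M := by
  refine forall_congr' fun v => ?_
  constructor
  · rintro ⟨e, ⟨he, hi⟩, hu⟩
    obtain ⟨d, rfl⟩ := (inc_iff _ _).1 hi
    exact ⟨d, he, fun d' hd' => edgeAt_injective v (hu _ ⟨hd', (inc_iff _ _).2 ⟨d', rfl⟩⟩)⟩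
  · rintro ⟨d, hd, hu⟩
    refine ⟨edgeAt v d, ⟨hd, (inc_iff _ _).2 ⟨d, rfl⟩⟩, ?_⟩
    rintro e ⟨he, hi⟩
    obtain ⟨d', rfl⟩ := (inc_iff _ _).1 hi
    rw [hu d' he]

theorem IsPerfectMatching.mem_iff {M : Set (Edge m n)} (hM : IsPerfectMatching M)
    (v : Node m n) (d : Dir) : edgeAt v d ∈ M ↔ d = matchDir M v := by
  obtain ⟨d₀, h, hu⟩ := (isPerfectMatching_iff M).1 hM v
  have hex : ∃ d, edgeAt v d ∈ M := ⟨d₀, h⟩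
  have h1 : matchDir M v = d₀ := by
    rw [matchDir, dif_pos hex]
    exact hu _ hex.choose_spec
  rw [h1]
  exact ⟨hu d, fun h => by rwa [h]⟩

theorem IsPerfectMatching.of_mem_iff {M : Set (Edge m n)} (f : Node m n → Dir)
    (h : ∀ v d, edgeAt v d ∈ M ↔ d = f v) : IsPerfectMatching M :=
  (isPerfectMatching_iff M).2 fun v => ⟨f v, (h v _).2 rfl, fun d hd => (h v d).1 hd⟩

theorem matchDir_eq {M : Set (Edge m n)} (f : Node m n → Dir)
    (h : ∀ v d, edgeAt v d ∈ M ↔ d = f v) (v : Node m n) : matchDir M v = f v :=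
  (h v _).1 (((IsPerfectMatching.of_mem_iff f h).mem_iff v _).2 rfl)

theorem IsPerfectMatching.matchDir_nbr {M : Set (Edge m n)} (hM : IsPerfectMatching M)
    (v : Node m n) : matchDir M (nbr v (matchDir M v)) = (matchDir M v).opp := by
  refine ((hM.mem_iff _ _).1 ?_).symm
  rw [edgeAt_nbr_opp]
  exact (hM.mem_iff _ _).2 rfl

theorem aligned_nbr_iff (v : Node m n) (d d' : Dir) :
    Aligned (nbr v d) v (nbr v d') ↔ d' = d ∨ d' = d.opp := by
  cases d <;> cases d' <;> simp [Aligned, nbr, Dir.opp, ne_sub_one]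

/-- At a white node alignment leaves two directions, along the matching edge and straight on; the
former is excluded because its edge lies in `M`. -/
theorem IsPerfectMatching.digraph_eq {M : Set (Edge m n)} (hM : IsPerfectMatching M) :
    digraph M = Set.range fun v => arcAt v (outDir M v) := by
  ext ⟨e, v, w⟩
  simp only [digraph, Set.mem_ofPred_eq, isLink_iff, Set.mem_range]
  constructor
  · rintro ⟨⟨d, rfl, rfl⟩, hb, hw⟩
    refine ⟨v, ?_⟩
    suffices outDir M v = d by rw [this]; rfl
    by_cases h : IsBlack v
    · rw [outDir_black h, (hM.mem_iff v d).1 (hb h)]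
    · rw [outDir_white h]
      obtain ⟨h1, h2⟩ := hw h
      rw [hM.mem_iff] at h1
      have h3 := h2 (edgeAt v (matchDir M v)) ((hM.mem_iff _ _).2 rfl) (nbr v (matchDir M v))
        ⟨(matchDir M v).opp, (edgeAt_nbr_opp _ _).symm, (nbr_nbr_opp _ _).symm⟩
      rw [aligned_nbr_iff] at h3
      exact (h3.resolve_left h1).symm
  · rintro ⟨v', h⟩
    simp only [arcAt, Arc.mk.injEq] at h
    obtain ⟨rfl, rfl, rfl⟩ := h
    refine ⟨⟨_, rfl, rfl⟩, fun h => ?_, fun h => ?_⟩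
    · rw [outDir_black h]; exact (hM.mem_iff _ _).2 rfl
    · rw [outDir_white h, hM.mem_iff]
      refine ⟨Dir.opp_ne _, ?_⟩
      rintro e he u ⟨d, rfl, rfl⟩
      have h1 : edgeAt (nbr u d) d.opp ∈ M := by rwa [edgeAt_nbr_opp]
      rw [hM.mem_iff] at h1
      have h2 : Aligned (nbr (nbr u d) d.opp) (nbr u d) (nbr (nbr u d) d.opp.opp) :=
        (aligned_nbr_iff _ _ _).2 (Or.inr rfl)
      rwa [nbr_nbr_opp, h1] at h2

end Nontrivial

/-! ### The grid is bipartite. -/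

section Colour

variable {m n : ℕ} [NeZero m] [NeZero n]
  [Fact (Even m)] [Fact (Even n)]

/-- As `k` is even, reduction modulo 2 is compatible with the wrap from `k - 1` to `0`. -/
theorem val_add_one_cast {k : ℕ} [NeZero k] [hk : Fact (Even k)] (a : ZMod k) :
    ((a + 1).val : ZMod 2) = (a.val : ZMod 2) + 1 := by
  have h : (2 : ℕ) ∣ k := hk.out.two_dvd
  simp only [ZMod.natCast_val]
  rw [ZMod.cast_add h, ZMod.cast_one h]

theorem val_sub_one_cast {k : ℕ} [NeZero k] [hk : Fact (Even k)] (a : ZMod k) :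
    ((a - 1).val : ZMod 2) = (a.val : ZMod 2) + 1 := by
  have h := val_add_one_cast (a - 1)
  rw [sub_add_cancel] at h
  rw [h, add_assoc]
  simp [show (1 : ZMod 2) + 1 = 0 from rfl]

theorem isBlack_nbr (v : Node m n) (d : Dir) : IsBlack (nbr v d) ↔ ¬ IsBlack v := by
  simp only [isBlack_iff]
  cases d <;> simp only [nbr, val_add_one_cast, val_sub_one_cast] <;>
    generalize (v.1.val : ZMod 2) = x <;> generalize (v.2.val : ZMod 2) = y <;>
    revert x y <;> decide

end Colour

/-! ### Dicycles as periodic orbits. -/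

section Orbit

variable {m n : ℕ} {M : Set (Edge m n)} {k : ℕ} {t : ZMod k → Node m n}

/-- The cyclic sequence of nodes visited by a dicycle of `D(M)`. -/
structure IsOrbit (M : Set (Edge m n)) (k : ℕ) (t : ZMod k → Node m n) : Prop where
  pos : 0 < k
  inj : Function.Injective t
  next : ∀ i, nbr (t i) (outDir M (t i)) = t (i + 1)

/-- The dicycle through the nodes of an orbit. -/
def orbitArcs (M : Set (Edge m n)) (t : ZMod k → Node m n) : Set (Arc m n) :=
  Set.range fun i => arcAt (t i) (outDir M (t i))

@[simp] theorem nodes_orbitArcs : nodes (orbitArcs M t) = Set.range t := by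
  rw [nodes, orbitArcs, ← Set.range_comp]
  rfl

theorem U_orbitArcs :
    U (orbitArcs M t) = Set.range fun i => edgeAt (t i) (outDir M (t i)) := by
  rw [U, orbitArcs, ← Set.range_comp]
  rfl

theorem orbitArcs_eq_image :
    orbitArcs M t = (fun v => arcAt v (outDir M v)) '' Set.range t := by
  rw [orbitArcs, ← Set.range_comp]
  rfl

theorem IsOrbit.isDicycle (h : IsOrbit M k t) : IsDicycle (orbitArcs M t) :=
  ⟨k, h.pos, _, h.inj, h.next, rfl⟩

/-- Orbits of one self-map that meet at a node agree from there on. -/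
theorem IsOrbit.range_subset {l : ℕ} {u : ZMod l → Node m n} (ht : IsOrbit M k t)
    (hu : IsOrbit M l u) {i : ZMod k} {j : ZMod l} (h : t i = u j) :
    Set.range t ⊆ Set.range u := by
  have key : ∀ x : ℕ, t (i + x) = u (j + x) := by
    intro x
    induction x with
    | zero => simpa using h
    | succ x ih =>
      rw [Nat.cast_succ, Nat.cast_succ, ← add_assoc, ← add_assoc, ← ht.next, ← hu.next, ih]
  rintro _ ⟨i', rfl⟩
  have : NeZero k := ⟨ht.pos.ne'⟩
  refine ⟨j + ((i' - i).val : ℕ), ?_⟩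
  rw [← key, ZMod.natCast_zmod_val, add_sub_cancel]

theorem IsOrbit.range_eq {l : ℕ} {u : ZMod l → Node m n} (ht : IsOrbit M k t)
    (hu : IsOrbit M l u) {i : ZMod k} {j : ZMod l} (h : t i = u j) :
    Set.range t = Set.range u :=
  (ht.range_subset hu h).antisymm (hu.range_subset ht h.symm)

end Orbit

section Dicycle

variable {m n : ℕ} [Nontrivial (ZMod m)] [Nontrivial (ZMod n)] {M : Set (Edge m n)}

theorem IsPerfectMatching.orbitArcs_subset (hM : IsPerfectMatching M) {k : ℕ}
    (t : ZMod k → Node m n) : orbitArcs M t ⊆ digraph M := by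
  rw [hM.digraph_eq]
  rintro _ ⟨i, rfl⟩
  exact ⟨t i, rfl⟩

theorem IsPerfectMatching.exists_orbit (hM : IsPerfectMatching M) {C : Set (Arc m n)}
    (hC : IsDicycle C) (hCM : C ⊆ digraph M) :
    ∃ k, ∃ t : ZMod k → Node m n, IsOrbit M k t ∧ C = orbitArcs M t := by
  obtain ⟨k, hk, a, hinj, hnext, rfl⟩ := hC
  have h : ∀ i, a i = arcAt (a i).tail (outDir M (a i).tail) := by
    intro i
    have h1 := hCM ⟨i, rfl⟩
    rw [hM.digraph_eq] at h1
    obtain ⟨v, hv⟩ := h1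
    have h2 : v = (a i).tail := congrArg Arc.tail hv
    rw [← h2, ← hv]
  refine ⟨k, fun i => (a i).tail, ⟨hk, hinj, fun i => ?_⟩, ?_⟩
  · rw [← hnext]
    exact (congrArg Arc.head (h i)).symm
  · exact congrArg Set.range (funext h)

theorem IsPerfectMatching.eq_of_nodes_eq (hM : IsPerfectMatching M) {C C' : Set (Arc m n)}
    (hC : IsDicycle C) (hCM : C ⊆ digraph M) (hC' : IsDicycle C') (hCM' : C' ⊆ digraph M)
    (h : nodes C = nodes C') : C = C' := by
  obtain ⟨k, t, -, rfl⟩ := hM.exists_orbit hC hCM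
  obtain ⟨l, u, -, rfl⟩ := hM.exists_orbit hC' hCM'
  simp only [nodes_orbitArcs] at h
  rw [orbitArcs_eq_image, orbitArcs_eq_image, h]

end Dicycle

/-! ### Flipping a matching along a dicycle. -/

section Reversal

variable {m n : ℕ} [Nontrivial (ZMod m)] [Nontrivial (ZMod n)] {M : Set (Edge m n)}
  {k : ℕ} {t : ZMod k → Node m n}

omit [Nontrivial (ZMod m)] [Nontrivial (ZMod n)] in
theorem IsOrbit.prev (ht : IsOrbit M k t) (i : ZMod k) :
    nbr (t (i - 1)) (outDir M (t (i - 1))) = t i := by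
  rw [ht.next, sub_add_cancel]

omit [Nontrivial (ZMod m)] [Nontrivial (ZMod n)] in
theorem IsOrbit.edgeAt_prev (ht : IsOrbit M k t) (i : ZMod k) :
    edgeAt (t i) (outDir M (t (i - 1))).opp = edgeAt (t (i - 1)) (outDir M (t (i - 1))) := by
  rw [← edgeAt_nbr_opp (t (i - 1)), ht.prev]

theorem IsOrbit.edgeAt_mem_U_iff (ht : IsOrbit M k t) (i : ZMod k) (d : Dir) :
    edgeAt (t i) d ∈ U (orbitArcs M t) ↔
      d = outDir M (t i) ∨ d = (outDir M (t (i - 1))).opp := by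
  simp only [U_orbitArcs, Set.mem_range]
  constructor
  · rintro ⟨j, hj⟩
    rcases eq_or_eq_of_edgeAt_eq hj.symm with ⟨h1, h2⟩ | ⟨h1, h2⟩
    · rw [ht.inj h1]; exact Or.inl h2
    · rw [ht.next] at h1
      rw [ht.inj h1, add_sub_cancel_right]; exact Or.inr h2
  · rintro (h | h)
    · exact ⟨i, by rw [h]⟩
    · exact ⟨i - 1, by rw [h, ht.edgeAt_prev]⟩

theorem IsOrbit.edgeAt_notMem_U (ht : IsOrbit M k t) {v : Node m n} (hv : v ∉ Set.range t)
    (d : Dir) : edgeAt v d ∉ U (orbitArcs M t) := by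
  simp only [U_orbitArcs, Set.mem_range]
  rintro ⟨j, hj⟩
  rcases eq_or_eq_of_edgeAt_eq hj.symm with ⟨h1, -⟩ | ⟨h1, -⟩
  · exact hv ⟨j, h1.symm⟩
  · rw [ht.next] at h1
    exact hv ⟨_, h1.symm⟩

variable [NeZero m] [NeZero n] [Fact (Even m)] [Fact (Even n)]

omit [Nontrivial (ZMod m)] [Nontrivial (ZMod n)] in
theorem IsOrbit.isBlack_succ (ht : IsOrbit M k t) (i : ZMod k) :
    IsBlack (t (i + 1)) ↔ ¬ IsBlack (t i) := by
  rw [← ht.next, isBlack_nbr]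

omit [Nontrivial (ZMod m)] [Nontrivial (ZMod n)] in
theorem IsOrbit.isBlack_pred (ht : IsOrbit M k t) (i : ZMod k) :
    IsBlack (t (i - 1)) ↔ ¬ IsBlack (t i) := by
  have := ht.isBlack_succ (i - 1)
  rw [sub_add_cancel] at this
  tauto

omit [NeZero m] [NeZero n] [Fact (Even m)] [Fact (Even n)] in
theorem IsPerfectMatching.matchDir_next (hM : IsPerfectMatching M) {v : Node m n}
    (hv : IsBlack v) : matchDir M (nbr v (outDir M v)) = (outDir M v).opp := by
  rw [outDir_black hv]
  exact hM.matchDir_nbr v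

theorem IsPerfectMatching.outDir_next (hM : IsPerfectMatching M) {v : Node m n}
    (hv : IsBlack v) : outDir M (nbr v (outDir M v)) = outDir M v := by
  rw [outDir_white (by rw [isBlack_nbr]; exact not_not.2 hv), hM.matchDir_next hv, Dir.opp_opp]

theorem IsOrbit.matchDir_white (ht : IsOrbit M k t) (hM : IsPerfectMatching M) {i : ZMod k}
    (hi : ¬ IsBlack (t i)) : matchDir M (t i) = (outDir M (t (i - 1))).opp := by
  rw [← hM.matchDir_next ((ht.isBlack_pred i).2 hi), ht.prev]

/-- Backtracking would identify the entering with the leaving edge, but the edge leaving a black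
node lies in `M` and the edge leaving a white node does not. -/
theorem IsOrbit.outDir_ne (ht : IsOrbit M k t) (hM : IsPerfectMatching M) (i : ZMod k) :
    outDir M (t i) ≠ (outDir M (t (i - 1))).opp := by
  by_cases hi : IsBlack (t i)
  · rw [outDir_black hi]
    intro h
    have h1 := (hM.mem_iff (t i) _).2 h.symm
    have h2 : ¬ IsBlack (t (i - 1)) := fun h => (ht.isBlack_pred i).1 h hi
    rw [ht.edgeAt_prev, hM.mem_iff, outDir_white h2] at h1
    exact Dir.opp_ne _ h1
  · rw [outDir_white hi, ht.matchDir_white hM hi]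
    exact Dir.opp_ne _

-- On the orbit, the flip rematches a black node to its predecessor and a white node to its
-- successor; elsewhere nothing changes.
open Classical in
theorem IsOrbit.mem_symmDiff_iff (ht : IsOrbit M k t) (hM : IsPerfectMatching M)
    (v : Node m n) (d : Dir) :
    edgeAt v d ∈ symmDiff M (U (orbitArcs M t)) ↔
      d = if h : v ∈ Set.range t then
        (if IsBlack v then (outDir M (t (h.choose - 1))).opp else outDir M v)
        else matchDir M v := by
  rw [Set.mem_symmDiff]
  split_ifs with h hb
  · obtain hi := h.choose_spec
    set i := h.choose
    rw [← hi] at hb ⊢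
    have h1 := ht.outDir_ne hM i
    rw [ht.edgeAt_mem_U_iff, hM.mem_iff, ← outDir_black hb]
    constructor
    · tauto
    · rintro rfl
      exact Or.inr ⟨Or.inr rfl, h1.symm⟩
  · obtain hi := h.choose_spec
    set i := h.choose
    rw [← hi] at hb ⊢
    have h1 := ht.outDir_ne hM i
    rw [ht.edgeAt_mem_U_iff, hM.mem_iff, ht.matchDir_white hM hb]
    constructor
    · tauto
    · rintro rfl
      exact Or.inr ⟨Or.inl rfl, h1⟩
  · have := ht.edgeAt_notMem_U h d
    rw [hM.mem_iff]
    tauto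

theorem IsOrbit.isPerfectMatching (ht : IsOrbit M k t) (hM : IsPerfectMatching M) :
    IsPerfectMatching (symmDiff M (U (orbitArcs M t))) :=
  IsPerfectMatching.of_mem_iff _ (ht.mem_symmDiff_iff hM)

theorem IsOrbit.matchDir_symmDiff_black (ht : IsOrbit M k t) (hM : IsPerfectMatching M)
    {i : ZMod k} (hi : IsBlack (t i)) :
    matchDir (symmDiff M (U (orbitArcs M t))) (t i) = (outDir M (t (i - 1))).opp := by
  have h : t i ∈ Set.range t := ⟨i, rfl⟩
  rw [matchDir_eq _ (ht.mem_symmDiff_iff hM), dif_pos h, if_pos hi, ht.inj h.choose_spec]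

theorem IsOrbit.matchDir_symmDiff_of_notMem (ht : IsOrbit M k t) (hM : IsPerfectMatching M)
    {v : Node m n} (hv : v ∉ Set.range t) :
    matchDir (symmDiff M (U (orbitArcs M t))) v = matchDir M v := by
  rw [matchDir_eq _ (ht.mem_symmDiff_iff hM), dif_neg hv]

theorem IsOrbit.outDir_symmDiff (ht : IsOrbit M k t) (hM : IsPerfectMatching M) (i : ZMod k) :
    outDir (symmDiff M (U (orbitArcs M t))) (t i) = (outDir M (t (i - 1))).opp := by
  by_cases hi : IsBlack (t i)
  · rw [outDir_black hi, ht.matchDir_symmDiff_black hM hi]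
  · have h : t i ∈ Set.range t := ⟨i, rfl⟩
    rw [outDir_white hi, matchDir_eq _ (ht.mem_symmDiff_iff hM), dif_pos h, if_neg hi,
      outDir_white hi, ht.matchDir_white hM hi, Dir.opp_opp]

theorem IsOrbit.outDir_symmDiff_of_notMem (ht : IsOrbit M k t) (hM : IsPerfectMatching M)
    {v : Node m n} (hv : v ∉ Set.range t) :
    outDir (symmDiff M (U (orbitArcs M t))) v = outDir M v := by
  simp only [outDir, ht.matchDir_symmDiff_of_notMem hM hv]

theorem IsOrbit.reverse (ht : IsOrbit M k t) (hM : IsPerfectMatching M) :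
    IsOrbit (symmDiff M (U (orbitArcs M t))) k fun i => t (-i) where
  pos := ht.pos
  inj := ht.inj.comp neg_injective
  next i := by
    rw [ht.outDir_symmDiff hM, neg_add, ← sub_eq_add_neg, ← ht.prev (-i), nbr_nbr_opp]

theorem IsOrbit.U_reverse (ht : IsOrbit M k t) (hM : IsPerfectMatching M) :
    U (orbitArcs (symmDiff M (U (orbitArcs M t))) fun i => t (-i)) = U (orbitArcs M t) := by
  have h : ∀ i, edgeAt (t (-i)) (outDir (symmDiff M (U (orbitArcs M t))) (t (-i))) =
      edgeAt (t (-i - 1)) (outDir M (t (-i - 1))) := fun i => by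
    rw [ht.outDir_symmDiff hM, ht.edgeAt_prev]
  rw [U_orbitArcs, funext h, U_orbitArcs]
  exact ((Equiv.neg (ZMod k)).trans (Equiv.subRight 1)).surjective.range_comp
    (fun i => edgeAt (t i) (outDir M (t i)))

/-- A dicycle meeting the flipped orbit has the same nodes, and survives reversed; a disjoint one
survives unchanged. -/
theorem IsOrbit.exists_nodes_eq (ht : IsOrbit M k t) (hM : IsPerfectMatching M)
    {D : Set (Arc m n)} (hD : IsDicycle D) (hDM : D ⊆ digraph M) :
    ∃ D', IsDicycle D' ∧ D' ⊆ digraph (symmDiff M (U (orbitArcs M t))) ∧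
      nodes D' = nodes D := by
  have hM' := ht.isPerfectMatching hM
  obtain ⟨l, u, hu, rfl⟩ := hM.exists_orbit hD hDM
  by_cases h : ∃ i j, t i = u j
  · obtain ⟨i, j, hij⟩ := h
    refine ⟨_, (ht.reverse hM).isDicycle, hM'.orbitArcs_subset _, ?_⟩
    rw [nodes_orbitArcs, nodes_orbitArcs, ← ht.range_eq hu hij]
    exact (Equiv.neg (ZMod k)).surjective.range_comp t
  · push Not at h
    have h1 : ∀ j, u j ∉ Set.range t := fun j ⟨i, hi⟩ => h i j hi
    have hu' : IsOrbit (symmDiff M (U (orbitArcs M t))) l u :=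
      ⟨hu.pos, hu.inj, fun j => by rw [ht.outDir_symmDiff_of_notMem hM (h1 j), hu.next]⟩
    exact ⟨_, hu'.isDicycle, hM'.orbitArcs_subset _, by simp⟩

end Reversal

/-! ### The first dicycle, and the involution. -/

section First

variable {m n : ℕ} [Nontrivial (ZMod m)] [Nontrivial (ZMod n)] {M : Set (Edge m n)}

omit [Nontrivial (ZMod m)] [Nontrivial (ZMod n)] in
theorem exists_isOrbit [NeZero m] [NeZero n] (M : Set (Edge m n)) :
    ∃ k, ∃ t : ZMod k → Node m n, IsOrbit M k t := by
  set g : Node m n → Node m n := fun v => nbr v (outDir M v) with hg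
  obtain ⟨x, y, hxy, h⟩ :=
    Finite.exists_ne_map_eq_of_infinite (fun x : ℕ => g^[x] (0 : Node m n))
  wlog hlt : x < y generalizing x y
  · exact this y x hxy.symm h.symm (by omega)
  set v := g^[x] 0
  have hp : Function.IsPeriodicPt g (y - x) v := by
    rw [Function.IsPeriodicPt, Function.IsFixedPt, ← Function.iterate_add_apply,
      Nat.sub_add_cancel hlt.le]
    exact h.symm
  have hpos : 0 < Function.minimalPeriod g v := hp.minimalPeriod_pos (by omega)
  have : NeZero (Function.minimalPeriod g v) := ⟨hpos.ne'⟩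
  refine ⟨Function.minimalPeriod g v, fun i => g^[i.val] v, hpos, fun i j hij => ?_, fun i => ?_⟩
  · exact ZMod.val_injective _ (Function.iterate_injOn_Iio_minimalPeriod
      (ZMod.val_lt i) (ZMod.val_lt j) hij)
  · change g (g^[i.val] v) = _
    rw [← Function.iterate_succ_apply' g, ← Function.iterate_mod_minimalPeriod_eq]
    congr 2
    rw [← ZMod.val_natCast, Nat.cast_succ, ZMod.natCast_zmod_val]

theorem exists_least {α : Type*} (r : α → α → Prop) [IsLinearOrder α r] {S : Set α}
    (hS : S.Finite) : S.Nonempty → ∃ x ∈ S, ∀ y ∈ S, r x y := by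
  induction S, hS using Set.Finite.induction_on with
  | empty => exact fun h => absurd h Set.not_nonempty_empty
  | @insert a S _ _ ih =>
    intro _
    rcases S.eq_empty_or_nonempty with rfl | hne
    · exact ⟨a, by simp, by simp [refl_of r]⟩
    · obtain ⟨x, hx, h⟩ := ih hne
      rcases total_of r a x with hax | hxa
      · refine ⟨a, by simp, ?_⟩
        rintro y (rfl | hy)
        · exact refl_of r _
        · exact trans_of r hax (h y hy)
      · refine ⟨x, Or.inr hx, ?_⟩
        rintro y (rfl | hy)
        · exact hxa
        · exact h y hy

variable (r : Set (Node m n) → Set (Node m n) → Prop) [IsLinearOrder (Set (Node m n)) r]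

theorem IsPerfectMatching.firstDicycle_unique (hM : IsPerfectMatching M) {C C' : Set (Arc m n)}
    (hC : IsFirstDicycle r M C) (hC' : IsFirstDicycle r M C') : C = C' :=
  hM.eq_of_nodes_eq hC.1.1 hC.1.2 hC'.1.1 hC'.1.2
    (antisymm_of r (hC.2 _ hC'.1.1 hC'.1.2) (hC'.2 _ hC.1.1 hC.1.2))

variable [NeZero m] [NeZero n]

theorem IsPerfectMatching.isFirstDicycle (hM : IsPerfectMatching M) :
    IsFirstDicycle r M (firstDicycle r M) := by
  have hex : ∃ C, IsFirstDicycle r M C := by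
    obtain ⟨k, t, ht⟩ := exists_isOrbit M
    obtain ⟨N, ⟨C, ⟨hC, hCM⟩, rfl⟩, hmin⟩ := exists_least r
      (Set.toFinite (nodes '' {C : Set (Arc m n) | IsDicycle C ∧ C ⊆ digraph M}))
      ⟨_, _, ⟨ht.isDicycle, hM.orbitArcs_subset t⟩, rfl⟩
    exact ⟨C, ⟨hC, hCM⟩, fun C' h1 h2 => hmin _ ⟨C', ⟨h1, h2⟩, rfl⟩⟩
  rw [firstDicycle, dif_pos hex]
  exact hex.choose_spec

theorem IsPerfectMatching.exists_orbit_firstDicycle (hM : IsPerfectMatching M) :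
    ∃ k, ∃ t : ZMod k → Node m n, IsOrbit M k t ∧ firstDicycle r M = orbitArcs M t :=
  hM.exists_orbit (hM.isFirstDicycle r).1.1 (hM.isFirstDicycle r).1.2

variable [Fact (Even m)] [Fact (Even n)]

theorem IsPerfectMatching.phi (hM : IsPerfectMatching M) : IsPerfectMatching (Phi r M) := by
  obtain ⟨k, t, ht, h⟩ := hM.exists_orbit_firstDicycle r
  rw [Phi, h]
  exact ht.isPerfectMatching hM

theorem IsPerfectMatching.phi_phi (hM : IsPerfectMatching M) : Phi r (Phi r M) = M := by
  obtain ⟨k, t, ht, h⟩ := hM.exists_orbit_firstDicycle r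
  have hM' := hM.phi r
  have h1 : Phi r M = symmDiff M (U (orbitArcs M t)) := by rw [Phi, h]
  have h2 : firstDicycle r (Phi r M) = orbitArcs (Phi r M) fun i => t (-i) := by
    refine hM'.firstDicycle_unique r (hM'.isFirstDicycle r) ⟨⟨?_, hM'.orbitArcs_subset _⟩, ?_⟩
    · rw [h1]
      exact (ht.reverse hM).isDicycle
    · intro D hD hDM
      rw [h1] at hDM
      -- Flipping the reversed orbit restores `M`, so `D` can be compared with a dicycle of `D(M)`,
      -- where minimality is known.
      obtain ⟨D', hD', hDM', hn⟩ :=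
        (ht.reverse hM).exists_nodes_eq (ht.isPerfectMatching hM) hD hDM
      rw [ht.U_reverse hM, symmDiff_symmDiff_cancel_right] at hDM'
      have h3 := (hM.isFirstDicycle r).2 D' hD' hDM'
      rw [h, hn] at h3
      convert h3 using 1
      rw [nodes_orbitArcs, nodes_orbitArcs]
      exact (Equiv.neg (ZMod k)).surjective.range_comp t
  rw [Phi, h2, h1, ht.U_reverse hM, symmDiff_symmDiff_cancel_right]

end First

/-! ### Cyclic order modulo 2 and telescoping sums. -/

section Order

/-- The indicator of `a < b` for the representatives in `{0, …, k-1}`, modulo `2`. -/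
def lt1 {k : ℕ} (a b : ZMod k) : ZMod 2 := if a.val < b.val then 1 else 0

/-- The indicator of `a = b`, modulo `2`. -/
def eq1 {k : ℕ} (a b : ZMod k) : ZMod 2 := if a = b then 1 else 0

variable {k : ℕ}

@[simp] theorem eq1_self (a : ZMod k) : eq1 a a = 1 := if_pos rfl

@[simp] theorem lt1_self (a : ZMod k) : lt1 a a = 0 := if_neg (lt_irrefl _)

theorem eq1_comm (a b : ZMod k) : eq1 a b = eq1 b a := by simp only [eq1, eq_comm]

@[simp] theorem eq1_add_one (a b : ZMod k) : eq1 (a + 1) (b + 1) = eq1 a b := by simp [eq1]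

theorem eq1_of_ne {a b : ZMod k} (h : a ≠ b) : eq1 a b = 0 := if_neg h

theorem sum_mul_eq1 [NeZero k] (f : ZMod k → ZMod 2) (a : ZMod k) :
    ∑ b, f b * eq1 a b = f a := by
  simp [eq1]

variable [NeZero k]

theorem lt1_swap (a b : ZMod k) : lt1 b a = 1 + eq1 a b + lt1 a b := by
  rcases lt_trichotomy a.val b.val with h | h | h
  · have : a ≠ b := by rintro rfl; exact lt_irrefl _ h
    simp only [lt1, eq1, if_pos h, if_neg h.not_gt, if_neg this]; rfl
  · simp [ZMod.val_injective _ h]; rfl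
  · have : a ≠ b := by rintro rfl; exact lt_irrefl _ h
    simp only [lt1, eq1, if_pos h, if_neg h.not_gt, if_neg this]; rfl

/-- The comparison changes when `a` reaches `b` and when it wraps from `k - 1` to `0`. -/
theorem lt1_add_one_left (a b : ZMod k) :
    lt1 (a + 1) b = lt1 a b + eq1 (a + 1) b + eq1 a (-1) := by
  by_cases ha : a = -1
  · subst ha
    have h1 : ¬ (-1 : ZMod k).val < b.val := by
      obtain ⟨l, rfl⟩ := Nat.exists_eq_succ_of_ne_zero (NeZero.ne k)
      rw [ZMod.val_neg_one]
      have := ZMod.val_lt b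
      omega
    rw [neg_add_cancel, lt1, lt1, eq1_self, if_neg h1, ZMod.val_zero]
    by_cases hb : b = 0
    · subst hb; simp; rfl
    · rw [eq1_of_ne (Ne.symm hb), if_pos (ZMod.val_pos.2 hb)]; rfl
  · have h1 : (a + 1).val = a.val + 1 := by
      have h2 := ZMod.val_lt a
      have h3 : a.val + 1 ≠ k := fun h => ha (eq_neg_of_add_eq_zero_left (by
        rw [← ZMod.natCast_zmod_val a, ← Nat.cast_succ, Nat.succ_eq_add_one, h,
          ZMod.natCast_self]))
      conv_lhs => rw [← ZMod.natCast_zmod_val a, ← Nat.cast_succ]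
      exact ZMod.val_cast_of_lt (by omega)
    rw [eq1_of_ne ha, add_zero, lt1, lt1, eq1, h1]
    have h2 : a + 1 = b ↔ a.val + 1 = b.val := by
      rw [← h1]; exact (ZMod.val_injective k).eq_iff.symm
    rw [if_congr h2 rfl rfl]
    split_ifs <;> first | omega | rfl

theorem lt1_add_one_right (a b : ZMod k) :
    lt1 a (b + 1) = lt1 a b + eq1 a b + eq1 b (-1) := by
  have h1 := lt1_swap (b + 1) a
  have h2 := lt1_swap b a
  have h3 := lt1_add_one_left b a
  have h4 := eq1_comm a b
  grind

/-- In use, `f j` counts vertical matching edges at column `j` of a row and `y j` the horizontal one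
from column `j` to `j + 1`. The sum up to `j` telescopes, leaving the last edge and the wrapping
edge `y (-1)`. -/
theorem sum_prefix (f y : ZMod k → ZMod 2)
    (h : ∀ j, f j = 1 + y j + y (j - 1)) (j : ZMod k) :
    ∑ i, f i * (1 + lt1 j i) = (j.val : ZMod 2) + 1 + y j + y (-1) := by
  have key : ∀ x : ℕ, x < k → ∑ i, f i * (if x < i.val then 0 else 1) =
      (x : ZMod 2) + 1 + y x + y (-1) := by
    intro x
    induction x with
    | zero =>
      intro _
      have h1 : ∀ i : ZMod k, (if 0 < i.val then (0 : ZMod 2) else 1) = eq1 0 i := by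
        intro i
        by_cases hi : i = 0
        · subst hi; simp
        · rw [if_pos (ZMod.val_pos.2 hi), eq1_of_ne (Ne.symm hi)]
      simp_rw [h1]
      rw [sum_mul_eq1, h]
      simp
    | succ x ih =>
      intro hx
      have h1 : ∀ i : ZMod k, (if x + 1 < i.val then (0 : ZMod 2) else 1) =
          (if x < i.val then 0 else 1) + eq1 ((x + 1 : ℕ) : ZMod k) i := by
        intro i
        have h2 : ((x + 1 : ℕ) : ZMod k) = i ↔ x + 1 = i.val := by
          rw [← (ZMod.val_injective k).eq_iff, ZMod.val_cast_of_lt hx]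
        rw [eq1, if_congr h2 rfl rfl]
        split_ifs <;> first | omega | rfl
      simp_rw [h1, mul_add]
      rw [Finset.sum_add_distrib, ih (by omega), sum_mul_eq1, h]
      push_cast
      rw [add_sub_cancel_right]
      grind
  have h1 := key j.val (ZMod.val_lt j)
  rw [ZMod.natCast_zmod_val] at h1
  rw [← h1]
  refine Finset.sum_congr rfl fun i _ => ?_
  rw [lt1]
  split_ifs <;> rfl

theorem sum_eq_zero_of_step (hk : Even k) (f y : ZMod k → ZMod 2)
    (h : ∀ j, f j = 1 + y j + y (j - 1)) : ∑ i, f i = 0 := by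
  have h1 := Equiv.sum_comp (Equiv.subRight (1 : ZMod k)) y
  simp only [Equiv.subRight_apply] at h1
  simp_rw [h]
  rw [Finset.sum_add_distrib, Finset.sum_add_distrib, h1]
  simp only [Finset.sum_const, Finset.card_univ, ZMod.card, nsmul_eq_mul, mul_one]
  rw [(ZMod.natCast_eq_zero_iff_even).2 hk]
  grind

theorem eq_of_add_one_eq {α : Type*} (f : ZMod k → α) (h : ∀ i, f (i + 1) = f i)
    (i j : ZMod k) : f i = f j := by
  have key : ∀ x : ℕ, f x = f 0 := by
    intro x
    induction x with
    | zero => simp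
    | succ x ih => rw [Nat.cast_succ, h, ih]
  rw [← ZMod.natCast_zmod_val i, ← ZMod.natCast_zmod_val j, key, key]

end Order

/-! ### Crossings of matching edges. -/

section Crossing

variable {m n : ℕ}

/-- The indicator of the lexicographic order of the nodes, modulo `2`. -/
def ltNode (u v : Node m n) : ZMod 2 := lt1 u.1 v.1 + eq1 u.1 v.1 * lt1 u.2 v.2

/-- Two disjoint edges cross, as arcs over the lexicographically ordered nodes. -/
def cross (e e' : Edge m n) : ZMod 2 :=
  ltNode e.ends.1 e'.ends.1 + ltNode e.ends.2 e'.ends.1 +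
    ltNode e.ends.1 e'.ends.2 + ltNode e.ends.2 e'.ends.2

/-- A bilinear form whose symmetrization counts crossings of disjoint edges. -/
def halfCross : Edge m n → Edge m n → ZMod 2
  | .vert p, .vert q => eq1 (p.1 + 1) q.1 * (1 + lt1 p.2 q.2) + eq1 p.1 q.1 * lt1 q.2 p.2
  | .vert p, .horiz q => (eq1 p.1 q.1 + eq1 (p.1 + 1) q.1) * eq1 q.2 (-1)
  | .horiz _, _ => 0

theorem eq1_mul_eq1_of_ne {u v : Node m n} (h : u ≠ v) : eq1 u.1 v.1 * eq1 u.2 v.2 = 0 := by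
  by_cases h1 : u.1 = v.1
  · rw [eq1_of_ne fun h2 => h (Prod.ext h1 h2), mul_zero]
  · rw [eq1_of_ne h1, zero_mul]

theorem halfCross_self [Nontrivial (ZMod m)] (e : Edge m n) : halfCross e e = 0 := by
  cases e <;> simp [halfCross, eq1_of_ne]

/-- The column of a vertical edge, modulo `2`, and `0` for a horizontal edge. -/
def col : Edge m n → ZMod 2
  | .vert p => p.2.val
  | .horiz _ => 0

/-- The indicator of a set of edges, modulo `2`. -/
noncomputable def ind (M : Set (Edge m n)) (e : Edge m n) : ZMod 2 :=
  open Classical in if e ∈ M then 1 else 0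

theorem ind_mul_self (M : Set (Edge m n)) (e : Edge m n) : ind M e * ind M e = ind M e := by
  rw [ind]; split_ifs <;> rfl

variable [NeZero m] [NeZero n]

theorem ltNode_swap {u v : Node m n} (h : u ≠ v) : ltNode v u = 1 + ltNode u v := by
  have h1 := eq1_mul_eq1_of_ne h
  have h2 := lt1_swap u.1 v.1
  have h3 := lt1_swap u.2 v.2
  have h4 := eq1_comm u.1 v.1
  unfold ltNode
  grind

/-- Vertical edges of one layer always cross; those of adjacent layers cross according to the order
of their ends in the common row. A horizontal edge joins consecutive nodes and crosses nothing,
unless it wraps and so spans its row: then it crosses the vertical edges with one end in that row.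
-/
theorem cross_eq {e e' : Edge m n} (h₁₁ : e.ends.1 ≠ e'.ends.1) (h₁₂ : e.ends.1 ≠ e'.ends.2)
    (h₂₁ : e.ends.2 ≠ e'.ends.1) (h₂₂ : e.ends.2 ≠ e'.ends.2) :
    cross e e' = halfCross e e' + halfCross e' e := by
  replace h₁₁ := eq1_mul_eq1_of_ne h₁₁
  replace h₁₂ := eq1_mul_eq1_of_ne h₁₂
  replace h₂₁ := eq1_mul_eq1_of_ne h₂₁
  replace h₂₂ := eq1_mul_eq1_of_ne h₂₂
  rcases e with ⟨i, j⟩ | ⟨i, j⟩ <;> rcases e' with ⟨i', j'⟩ | ⟨i', j'⟩ <;>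
    simp only [Edge.ends, cross, halfCross, ltNode, eq1_add_one, lt1_add_one_left,
      lt1_add_one_right, eq1_comm i' i, eq1_comm (i' + 1) i, lt1_swap j j'] at *
  all_goals grind

/-- The parity of the number of edges in the layer `A`. -/
noncomputable def parA (M : Set (Edge m n)) : ZMod 2 := ∑ j, ind M (.vert (-1, j))

/-- The parity of the number of edges in the layer `B`. -/
noncomputable def parB (M : Set (Edge m n)) : ZMod 2 := ∑ i, ind M (.horiz (i, -1))

variable [Nontrivial (ZMod m)] [Nontrivial (ZMod n)] {M : Set (Edge m n)}

omit [NeZero m] [NeZero n] in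
open Classical in
theorem IsPerfectMatching.ind_eq (hM : IsPerfectMatching M) (v : Node m n) (d : Dir) :
    ind M (edgeAt v d) = if d = matchDir M v then 1 else 0 := by
  simp only [ind, hM.mem_iff]

omit [NeZero m] [NeZero n] in
theorem IsPerfectMatching.ind_down_mul_right (hM : IsPerfectMatching M) (v : Node m n) :
    ind M (edgeAt v .down) * ind M (edgeAt v .right) = 0 := by
  rw [hM.ind_eq, hM.ind_eq]
  cases matchDir M v <;> simp

omit [NeZero m] [NeZero n] in
theorem IsPerfectMatching.ind_sum (hM : IsPerfectMatching M) (v : Node m n) :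
    ind M (edgeAt v .up) + ind M (edgeAt v .down) =
      1 + ind M (edgeAt v .right) + ind M (edgeAt v .left) := by
  simp only [hM.ind_eq]
  cases matchDir M v <;> simp <;> rfl

/-- A row has an even number of nodes, and those matched horizontally pair up within it, so the
layers above and below have equal parity. -/
theorem IsPerfectMatching.row_sum (hn : Even n) (hM : IsPerfectMatching M) (i : ZMod m) :
    ∑ j, ind M (.vert (i, j)) = parA M := by
  refine eq_of_add_one_eq (fun i => ∑ j, ind M (.vert (i, j))) (fun i => ?_) i (-1)
  have h := sum_eq_zero_of_step hn
    (fun j => ind M (.vert (i + 1, j)) + ind M (.vert (i, j)))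
    (fun j => ind M (.horiz (i + 1, j))) (fun j => by
      have := hM.ind_sum (i + 1, j)
      simpa only [edgeAt, add_sub_cancel_right] using this)
  rw [Finset.sum_add_distrib] at h
  grind

/-- For a fixed vertical edge at `(i, j)` of `M`, the wrapping edges of row `i + 1` cancel, and `j`
plus the wrapping edge of row `i` remains. Summing the latter over layers of constant parity gives
`parA M * parB M`. -/
theorem IsPerfectMatching.sum_halfCross (hn : Even n) (hM : IsPerfectMatching M) :
    ∑ p, ind M (.vert p) * (∑ q, ind M (.vert q) * halfCross (.vert p) (.vert q) +
      ∑ q, ind M (.horiz q) * halfCross (.vert p) (.horiz q)) =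
    ∑ p, ind M (.vert p) * col (.vert p) + parA M * parB M := by
  have h1 : ∀ i j, ind M (.vert (i, j)) *
      (∑ q, ind M (.vert q) * halfCross (.vert (i, j)) (.vert q) +
        ∑ q, ind M (.horiz q) * halfCross (.vert (i, j)) (.horiz q)) =
      ind M (.vert (i, j)) * col (.vert (i, j)) +
        ind M (.horiz (i, -1)) * ind M (.vert (i, j)) := by
    intro i j
    have hh : ∑ q, ind M (.horiz q) * halfCross (.vert (i, j)) (.horiz q) =
        ind M (.horiz (i, -1)) + ind M (.horiz (i + 1, -1)) := by
      rw [Fintype.sum_prod_type]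
      simp only [halfCross]
      have : ∀ i' : ZMod m, ∑ j' : ZMod n,
          ind M (.horiz (i', j')) * ((eq1 i i' + eq1 (i + 1) i') * eq1 j' (-1)) =
          ind M (.horiz (i', -1)) * eq1 i i' + ind M (.horiz (i', -1)) * eq1 (i + 1) i' := by
        intro i'
        simp_rw [eq1_comm _ (-1 : ZMod n), ← mul_assoc]
        rw [sum_mul_eq1 (fun j' => ind M (.horiz (i', j')) * (eq1 i i' + eq1 (i + 1) i')), mul_add]
      simp_rw [this]
      rw [Finset.sum_add_distrib, sum_mul_eq1 (fun i' => ind M (.horiz (i', -1))),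
        sum_mul_eq1 (fun i' => ind M (.horiz (i', -1)))]
    have hv : ∑ q, ind M (.vert q) * halfCross (.vert (i, j)) (.vert q) =
        (j.val : ZMod 2) + 1 + ind M (.horiz (i + 1, j)) + ind M (.horiz (i + 1, -1)) +
          ind M (.vert (i, j)) := by
      rw [← sum_prefix (fun j' => ind M (.vert (i + 1, j')) + ind M (.vert (i, j')))
        (fun j => ind M (.horiz (i + 1, j))) (fun j => by
          have := hM.ind_sum (i + 1, j)
          simpa only [edgeAt, add_sub_cancel_right] using this) j,
        Fintype.sum_prod_type, Finset.sum_comm,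
        ← sum_mul_eq1 (fun j' => ind M (.vert (i, j'))) j, ← Finset.sum_add_distrib]
      refine Finset.sum_congr rfl fun j' _ => ?_
      simp only [halfCross]
      have : ∀ i' : ZMod m, ind M (.vert (i', j')) *
          (eq1 (i + 1) i' * (1 + lt1 j j') + eq1 i i' * lt1 j' j) =
          (ind M (.vert (i', j')) * (1 + lt1 j j')) * eq1 (i + 1) i' +
            (ind M (.vert (i', j')) * lt1 j' j) * eq1 i i' := fun i' => by ring
      simp_rw [this]
      rw [Finset.sum_add_distrib,
        sum_mul_eq1 (fun i' => ind M (.vert (i', j')) * (1 + lt1 j j')),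
        sum_mul_eq1 (fun i' => ind M (.vert (i', j')) * lt1 j' j), lt1_swap j j']
      ring
    -- The node `(i + 1, j)` cannot be matched both down and right.
    have h2 : ind M (.vert (i, j)) * ind M (.horiz (i + 1, j)) = 0 := by
      have := hM.ind_down_mul_right (i + 1, j)
      simpa only [edgeAt, add_sub_cancel_right] using this
    have h3 := ind_mul_self M (.vert (i, j))
    rw [hh, hv]
    simp only [col]
    grind
  rw [Fintype.sum_prod_type, Fintype.sum_prod_type]
  simp_rw [h1, Finset.sum_add_distrib, ← Finset.mul_sum,
    hM.row_sum hn, ← Finset.sum_mul]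
  rw [mul_comm (parA M), parB]

end Crossing

/-! ### Permutation signs from inversions modulo 2. -/

section Sign

theorem neg_one_uzpow_sum {ι : Type*} (s : Finset ι) (f : ι → ZMod 2) :
    (-1 : ℤˣ) ^ (∑ i ∈ s, f i) = ∏ i ∈ s, (-1 : ℤˣ) ^ f i := by
  classical
  induction s using Finset.induction_on with
  | empty => simp
  | insert a s ha ih => rw [Finset.sum_insert ha, Finset.prod_insert ha, uzpow_add, ih]

theorem neg_one_uzpow_injective : Function.Injective fun a : ZMod 2 => (-1 : ℤˣ) ^ a := by
  decide

theorem neg_one_uzpow_sum_comp {N : ℕ} (σ : Equiv.Perm (Fin N)) (f : Fin N → Fin N → ZMod 2)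
    (hf : ∀ i j, i ≠ j → f j i = 1 + f i j) :
    (-1 : ℤˣ) ^ (∑ j, ∑ i ∈ Finset.Iio j, f (σ i) (σ j)) =
      Equiv.Perm.sign σ * (-1 : ℤˣ) ^ (∑ j, ∑ i ∈ Finset.Iio j, f i j) := by
  have h := σ.prod_Iio_comp_eq_sign_mul_prod (R := ℤ)
    -- The diagonal value 0 makes the function antisymmetric; it never enters the products over `i <
    -- j`.
    (f := fun i j => if i = j then 0 else (((-1 : ℤˣ) ^ f i j : ℤˣ) : ℤ)) (fun i j => by
      by_cases hij : i = j
      · simp [hij]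
      · rw [if_neg hij, if_neg (Ne.symm hij), hf i j hij, uzpow_add]
        simp)
  have h1 : ∀ τ : Equiv.Perm (Fin N),
      ∏ j, ∏ i ∈ Finset.Iio j, (if τ i = τ j then 0 else (((-1 : ℤˣ) ^ f (τ i) (τ j) : ℤˣ) : ℤ)) =
        (((-1 : ℤˣ) ^ (∑ j, ∑ i ∈ Finset.Iio j, f (τ i) (τ j)) : ℤˣ) : ℤ) := by
    intro τ
    simp_rw [neg_one_uzpow_sum, Units.coe_prod]
    refine Finset.prod_congr rfl fun j _ => Finset.prod_congr rfl fun i hi => ?_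
    rw [if_neg (τ.injective.ne (Finset.mem_Iio.1 hi).ne)]
  rw [h1 σ] at h
  have h2 := h.trans (congrArg (_ * ·) (h1 1))
  rw [Int.cast_id] at h2
  exact Units.ext h2

theorem sum_Iio_symm {N : ℕ} (f : Fin N → Fin N → ZMod 2) :
    ∑ j, ∑ i ∈ Finset.Iio j, (f i j + f j i) = ∑ i, ∑ j, f i j + ∑ i, f i i := by
  have h := Finset.sum_sum_Ioi_add_eq_sum_sum_off_diag f
  have h1 : ∀ i, ∑ j ∈ ({i}ᶜ : Finset (Fin N)), f j i = ∑ j, f j i + f i i := by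
    intro i
    rw [← Finset.sum_compl_add_sum {i}, Finset.sum_singleton]
    grind
  simp_rw [h1] at h
  rw [Finset.sum_add_distrib, Finset.sum_comm (f := fun i j => f j i)] at h
  rw [← h]
  refine (Finset.sum_comm' (t' := Finset.univ) (s' := fun i => Finset.Ioi i) (by simp)).trans ?_
  exact Finset.sum_congr rfl fun i _ => Finset.sum_congr rfl fun j _ => add_comm _ _

end Sign

/-! ### Inversions of the partner map. -/

section Black

/-- The black nodes. -/
abbrev Black (m n : ℕ) : Type := {v : Node m n // IsBlack v}

variable {m n : ℕ} {M : Set (Edge m n)}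

/-- The matching edge at a node. -/
noncomputable def matchEdge (M : Set (Edge m n)) (v : Node m n) : Edge m n :=
  edgeAt v (matchDir M v)

/-- The node matched to a node. -/
noncomputable def partner (M : Set (Edge m n)) (v : Node m n) : Node m n := nbr v (matchDir M v)

theorem cross_edgeAt (u v : Node m n) (d d' : Dir) :
    cross (edgeAt u d) (edgeAt v d') = ltNode u v + ltNode (nbr u d) (nbr v d') +
      (ltNode u (nbr v d') + ltNode (nbr u d) v) := by
  cases d <;> cases d' <;> simp only [edgeAt, nbr, cross, Edge.ends, sub_add_cancel] <;> ring

/-- Edges that cross the boundary of the fundamental domain, modulo `2`. -/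
def wrap : Edge m n → ZMod 2
  | .vert p => eq1 (-1) p.1
  | .horiz p => eq1 (-1) p.2

/-- The directions against the orientation of the coordinate axes, modulo `2`. -/
def Dir.negative : Dir → ZMod 2
  | .up => 0
  | .down => 1
  | .right => 0
  | .left => 1

theorem Dir.negative_opp (d : Dir) : d.opp.negative = d.negative + 1 := by
  cases d <;> rfl

theorem col_edgeAt_nbr (v : Node m n) (d : Dir) : col (edgeAt (nbr v d) d) = col (edgeAt v d) := by
  cases d <;> rfl

variable [Nontrivial (ZMod m)] [Nontrivial (ZMod n)]

theorem IsPerfectMatching.partner_partner (hM : IsPerfectMatching M) (v : Node m n) :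
    partner M (partner M v) = v := by
  rw [partner, partner, hM.matchDir_nbr, nbr_nbr_opp]

theorem IsPerfectMatching.partner_injective (hM : IsPerfectMatching M) :
    Function.Injective (partner M) :=
  Function.Involutive.injective hM.partner_partner

variable [NeZero m] [NeZero n]

theorem ltNode_nbr (v : Node m n) (d : Dir) :
    ltNode v (nbr v d) = 1 + d.negative + wrap (edgeAt v d) := by
  have h1 := lt1_add_one_left (v.1 - 1) (v.1 - 1)
  have h2 := lt1_add_one_left (v.2 - 1) (v.2 - 1)
  rw [sub_add_cancel, eq1_of_ne (ne_sub_one v.1), lt1_self] at h1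
  rw [sub_add_cancel, eq1_of_ne (ne_sub_one v.2), lt1_self] at h2
  have h3 := eq1_comm (-1) v.1
  have h4 := eq1_comm (-1) v.2
  have h5 := eq1_comm (-1) (v.1 - 1)
  have h6 := eq1_comm (-1) (v.2 - 1)
  have h7 : eq1 v.1 (v.1 + 1) = 0 := eq1_of_ne (by simp)
  have h8 : eq1 v.1 (v.1 - 1) = 0 := eq1_of_ne (ne_sub_one v.1)
  cases d <;> simp only [ltNode, nbr, edgeAt, wrap, Dir.negative, lt1_add_one_right, eq1_self,
    lt1_self] <;> grind

omit [Nontrivial (ZMod m)] [Nontrivial (ZMod n)] in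
theorem parA_add_parB (M : Set (Edge m n)) :
    ∑ p, ind M (.vert p) * wrap (.vert p) + ∑ p, ind M (.horiz p) * wrap (.horiz p) =
      parA M + parB M := by
  rw [Fintype.sum_prod_type, Fintype.sum_prod_type, Finset.sum_comm]
  simp only [wrap]
  rw [parA, parB]
  congr 1
  · exact Finset.sum_congr rfl fun j _ => sum_mul_eq1 (fun i => ind M (.vert (i, j))) _
  · exact Finset.sum_congr rfl fun i _ => sum_mul_eq1 (fun j => ind M (.horiz (i, j))) _

variable [Fact (Even m)] [Fact (Even n)]

-- Each matching edge has exactly one black end.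
open Classical in
theorem IsPerfectMatching.sum_matchEdge (hM : IsPerfectMatching M) (g : Edge m n → ZMod 2) :
    ∑ b : Black m n, g (matchEdge M b) =
      ∑ p, ind M (.vert p) * g (.vert p) + ∑ p, ind M (.horiz p) * g (.horiz p) := by
  have h1 : ∀ c : Node m n → Edge m n, ∑ p, ind M (c p) * g (c p) =
      ∑ p with c p ∈ M, g (c p) := by
    intro c
    rw [Finset.sum_filter]
    refine Finset.sum_congr rfl fun p _ => ?_
    rw [ind]
    split_ifs <;> simp
  rw [h1, h1]
  let e : Node m n ⊕ Node m n → Edge m n := Sum.elim .vert .horiz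
  let c : Black m n → Node m n ⊕ Node m n := fun b =>
    match matchEdge M b with
    | .vert p => .inl p
    | .horiz p => .inr p
  have hc : ∀ b, e (c b) = matchEdge M b := by
    intro b
    simp only [c, e]
    cases matchEdge M b.1 <;> rfl
  have he : Function.Injective e := by
    rintro (p | p) (q | q) h <;> simp [e] at h ⊢ <;> exact h
  refine Eq.trans ?_ (Finset.sum_disjSum _ _ (g ∘ e))
  refine Finset.sum_bij (fun b _ => c b) (fun b _ => ?_) (fun b _ b' _ h => ?_)
    (fun x hx => ?_) (fun b _ => ?_)
  · have h := hc b
    have h2 : matchEdge M b ∈ M := (hM.mem_iff _ _).2 rfl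
    rw [← h] at h2
    rcases hcb : c b with p | p <;> rw [hcb] at h2 <;> simpa [e] using h2
  · have h2 : matchEdge M b = matchEdge M b' := by rw [← hc, ← hc, h]
    rcases eq_or_eq_of_edgeAt_eq h2 with ⟨h3, -⟩ | ⟨h3, -⟩
    · exact Subtype.ext h3
    · have h4 := b.2
      rw [h3, isBlack_nbr] at h4
      exact absurd b'.2 h4
  · have hx' : e x ∈ M := by
      rcases x with p | p <;> simpa [e] using hx
    obtain ⟨v, d, hd⟩ : ∃ v d, e x = edgeAt v d := by
      rcases x with p | p
      · exact ⟨p, .up, rfl⟩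
      · exact ⟨p, .right, rfl⟩
    rw [hd] at hx'
    by_cases hv : IsBlack v
    · refine ⟨⟨v, hv⟩, Finset.mem_univ _, he ?_⟩
      rw [hc, hd, matchEdge, (hM.mem_iff _ _).1 hx']
    · refine ⟨⟨nbr v d, (isBlack_nbr v d).2 hv⟩, Finset.mem_univ _, he ?_⟩
      rw [← edgeAt_nbr_opp] at hx'
      rw [hc, hd, matchEdge, ← (hM.mem_iff _ _).1 hx', edgeAt_nbr_opp]
  · rw [Function.comp_apply, hc]

open Classical in
theorem IsPerfectMatching.sum_partner (hM : IsPerfectMatching M) (g : Node m n → ZMod 2) :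
    ∑ b : Black m n, g (partner M b) = ∑ w with ¬ IsBlack w, g w := by
  refine Finset.sum_bij (fun b _ => partner M b) (fun b _ => ?_) (fun b _ b' _ h => ?_)
    (fun w hw => ?_) (fun b _ => rfl)
  · simpa [partner, isBlack_nbr] using b.2
  · exact Subtype.ext (hM.partner_injective h)
  · refine ⟨⟨partner M w, ?_⟩, Finset.mem_univ _, hM.partner_partner w⟩
    simpa [partner, isBlack_nbr] using hw

open Classical in
theorem IsPerfectMatching.sum_halfCross_matchEdge (hM : IsPerfectMatching M) :
    ∑ b : Black m n, ∑ b' : Black m n, halfCross (matchEdge M b) (matchEdge M b') =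
      ∑ b : Black m n, col (matchEdge M b) + parA M * parB M := by
  simp_rw [hM.sum_matchEdge]
  have h := hM.sum_halfCross Fact.out
  rw [hM.sum_matchEdge fun e =>
    ∑ p, ind M (.vert p) * halfCross e (.vert p) + ∑ p, ind M (.horiz p) * halfCross e (.horiz p),
    h]
  simp [halfCross, col]

theorem IsPerfectMatching.cross_matchEdge (hM : IsPerfectMatching M) {b b' : Node m n}
    (hb : IsBlack b) (hb' : IsBlack b') (h : b ≠ b') :
    cross (matchEdge M b) (matchEdge M b') =
      halfCross (matchEdge M b) (matchEdge M b') + halfCross (matchEdge M b') (matchEdge M b) := by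
  have h1 : ∀ v d, ((edgeAt v d).ends.1 = v ∧ (edgeAt v d).ends.2 = nbr v d) ∨
      ((edgeAt v d).ends.2 = v ∧ (edgeAt v d).ends.1 = nbr (m := m) (n := n) v d) := by
    intro v d
    cases d <;> simp [edgeAt, Edge.ends, nbr]
  have h2 : partner M b ≠ partner M b' := hM.partner_injective.ne h
  have h3 : b ≠ partner M b' := by
    rintro rfl
    exact (isBlack_nbr _ _).1 hb hb'
  have h4 : partner M b ≠ b' := by
    rintro rfl
    exact (isBlack_nbr _ _).1 hb' hb
  apply cross_eq <;>
  rcases h1 b (matchDir M b) with ⟨h5, h6⟩ | ⟨h5, h6⟩ <;>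
  rcases h1 b' (matchDir M b') with ⟨h7, h8⟩ | ⟨h7, h8⟩ <;>
  simp only [matchEdge, h5, h6, h7, h8] <;> assumption

/-- The number of inversions, modulo `2`, of the white partners of the black nodes. -/
noncomputable def inversions {N : ℕ} (β : Fin N ≃ Black m n) (M : Set (Edge m n)) : ZMod 2 :=
  ∑ j, ∑ i ∈ Finset.Iio j, ltNode (partner M (β i)) (partner M (β j))

/-- The part of the number of inversions that is a sum over the matching edges, modulo `2`. -/
noncomputable def edgeSum {N : ℕ} (β : Fin N ≃ Black m n) (M : Set (Edge m n)) : ZMod 2 :=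
  ∑ i, (col (matchEdge M (β i)) + (matchDir M (β i)).negative)

-- The crossings are counted twice: by `halfCross`, and by expanding `cross` into comparisons of
-- black and white ends.
open Classical in
theorem exists_inversions_eq {N : ℕ} (β : Fin N ≃ Black m n) :
    ∃ c, ∀ M : Set (Edge m n), IsPerfectMatching M →
      inversions β M = c + edgeSum β M + (parA M * parB M + parA M + parB M) := by
  refine ⟨∑ j, ∑ i ∈ Finset.Iio j, (ltNode (β i : Node m n) (β j) + 1) +
    ∑ i, ∑ w with ¬ IsBlack w, ltNode (β i : Node m n) w + ∑ i : Fin N, 1, fun M hM => ?_⟩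
  have hsum : ∀ g : Black m n → ZMod 2, ∑ i, g (β i) = ∑ b, g b := fun g => Equiv.sum_comp β g
  have h1 : ∑ j, ∑ i ∈ Finset.Iio j, cross (matchEdge M (β i)) (matchEdge M (β j)) =
      ∑ i, col (matchEdge M (β i)) + parA M * parB M := by
    have h : ∀ j, ∀ i ∈ Finset.Iio j, cross (matchEdge M (β i)) (matchEdge M (β j)) =
        halfCross (matchEdge M (β i)) (matchEdge M (β j)) +
          halfCross (matchEdge M (β j)) (matchEdge M (β i)) := fun j i hij =>
      hM.cross_matchEdge (β i).2 (β j).2 fun h =>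
        (Finset.mem_Iio.1 hij).ne (β.injective (Subtype.ext h))
    rw [Finset.sum_congr rfl fun j _ => Finset.sum_congr rfl (h j),
      sum_Iio_symm fun i j => halfCross (matchEdge M (β i)) (matchEdge M (β j))]
    simp_rw [halfCross_self, Finset.sum_const_zero, add_zero]
    rw [hsum fun b => ∑ j, halfCross (matchEdge M b) (matchEdge M (β j)),
      hsum fun b => col (matchEdge M b), ← hM.sum_halfCross_matchEdge]
    exact Finset.sum_congr rfl fun b _ => hsum fun b' => halfCross (matchEdge M b) (matchEdge M b')
  -- Swapping one mixed comparison puts the black node first in both, so that they add up over all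
  -- ordered pairs, up to the diagonal.
  have h2 : ∀ j, ∀ i ∈ Finset.Iio j, cross (matchEdge M (β i)) (matchEdge M (β j)) =
      (ltNode (β i : Node m n) (β j) + 1) + ltNode (partner M (β i)) (partner M (β j)) +
        (ltNode (β i : Node m n) (partner M (β j)) +
          ltNode (β j : Node m n) (partner M (β i))) := by
    intro j i _
    have hne : (β j : Node m n) ≠ partner M (β i) := by
      intro h
      have := (β j).2
      rw [h, partner, isBlack_nbr] at this
      exact this (β i).2
    have h3 := ltNode_swap hne
    rw [matchEdge, matchEdge, cross_edgeAt]
    change _ + ltNode (partner M (β i)) (partner M (β j)) +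
      (ltNode _ (partner M (β j)) + ltNode (partner M (β i)) _) = _
    rw [h3]
    ring
  rw [Finset.sum_congr rfl fun j _ => Finset.sum_congr rfl (h2 j)] at h1
  simp_rw [Finset.sum_add_distrib (f := fun i => _ + ltNode (partner M _) _)] at h1
  simp_rw [Finset.sum_add_distrib (g := fun i => ltNode (partner M _) _)] at h1
  rw [Finset.sum_add_distrib, Finset.sum_add_distrib,
    sum_Iio_symm fun i j => ltNode (β i : Node m n) (partner M (β j))] at h1
  have h3 : ∀ i, ∑ j, ltNode (β i : Node m n) (partner M (β j)) =
      ∑ w with ¬ IsBlack w, ltNode (β i : Node m n) w := fun i => by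
    rw [hsum fun b => ltNode (β i : Node m n) (partner M b), hM.sum_partner]
  -- The diagonal compares each black node with its own partner; this is the source of `parA M +
  -- parB M`.
  have h4 : ∑ i, ltNode (β i : Node m n) (partner M (β i)) =
      ∑ i : Fin N, 1 + ∑ i, (matchDir M (β i)).negative + (parA M + parB M) := by
    simp_rw [partner, ltNode_nbr]
    rw [Finset.sum_add_distrib, Finset.sum_add_distrib, ← parA_add_parB, ← hM.sum_matchEdge,
      hsum fun b => wrap (edgeAt b.1 (matchDir M b))]
    rfl
  simp_rw [h3] at h1
  rw [h4] at h1
  rw [edgeSum, Finset.sum_add_distrib]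
  rw [inversions]
  grind

end Black

/-! ### A flip changes the parity. -/

section Flip

variable {m n : ℕ} [Nontrivial (ZMod m)] [Nontrivial (ZMod n)] [NeZero m] [NeZero n]
  [Fact (Even m)] [Fact (Even n)] {M : Set (Edge m n)} {k : ℕ} {t : ZMod k → Node m n}

omit [Nontrivial (ZMod m)] [Nontrivial (ZMod n)] in
theorem IsOrbit.exists_black (ht : IsOrbit M k t) :
    ∃ t' : ZMod k → Node m n, IsOrbit M k t' ∧ orbitArcs M t' = orbitArcs M t ∧
      IsBlack (t' 0) := by
  by_cases h : IsBlack (t 0)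
  · exact ⟨t, ht, rfl, h⟩
  · refine ⟨fun i => t (i + 1), ⟨ht.pos, ht.inj.comp (add_left_injective 1), fun i => ht.next _⟩,
      (Equiv.addRight (1 : ZMod k)).surjective.range_comp fun i => arcAt (t i) (outDir M (t i)), ?_⟩
    rwa [ht.isBlack_succ]

omit [Nontrivial (ZMod m)] [Nontrivial (ZMod n)] in
theorem IsOrbit.isBlack_natCast (ht : IsOrbit M k t) (h : IsBlack (t 0)) (x : ℕ) :
    IsBlack (t x) ↔ Even x := by
  induction x with
  | zero => simpa using h
  | succ x ih => rw [Nat.cast_succ, ht.isBlack_succ, ih, Nat.even_add_one]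

omit [Nontrivial (ZMod m)] [Nontrivial (ZMod n)] in
theorem IsOrbit.even (ht : IsOrbit M k t) (h : IsBlack (t 0)) : Even k := by
  rw [← ht.isBlack_natCast h, ZMod.natCast_self]
  exact h

/-- The parity that distinguishes the perfect matchings of type `EE` from all others. -/
noncomputable def parity (M : Set (Edge m n)) : ZMod 2 := parA M * parB M + parA M + parB M

-- White nodes keep their place while their black partners advance by one along the orbit.
open Classical in
theorem IsOrbit.inversions_edgeSum_symmDiff {l : ℕ} {t : ZMod (2 * (l + 1)) → Node m n}
    (ht : IsOrbit M (2 * (l + 1)) t) (hM : IsPerfectMatching M) (h0 : IsBlack (t 0))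
    {N : ℕ} (β : Fin N ≃ Black m n) :
    inversions β M = l + inversions β (symmDiff M (U (orbitArcs M t))) ∧
      edgeSum β (symmDiff M (U (orbitArcs M t))) = edgeSum β M + (l + 1) := by
  set M' := symmDiff M (U (orbitArcs M t)) with hM'
  have hb : ∀ s : Fin (l + 1), IsBlack (t ((2 * s.val : ℕ) : ZMod (2 * (l + 1)))) := fun s =>
    (ht.isBlack_natCast h0 _).2 (even_two_mul _)
  -- The black nodes of the orbit are those at even positions.
  let γ : Fin (l + 1) ↪ Fin N := ⟨fun s => β.symm ⟨_, hb s⟩, fun s s' h => by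
    have h1 := ht.inj (congrArg Subtype.val (β.symm.injective h))
    have h2 := congrArg ZMod.val h1
    rw [ZMod.val_cast_of_lt (by omega), ZMod.val_cast_of_lt (by omega)] at h2
    exact Fin.ext (by omega)⟩
  have hγ : ∀ s, (β (γ s) : Node m n) = t ((2 * s.val : ℕ) : ZMod (2 * (l + 1))) := fun s => by
    simp [γ]
  have hnot : ∀ i, i ∉ Set.range γ → (β i : Node m n) ∉ Set.range t := by
    rintro i hi ⟨x, hx⟩
    have h1 : IsBlack (t (x.val : ℕ)) := by
      rw [ZMod.natCast_zmod_val, hx]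
      exact (β i).2
    obtain ⟨s, hs⟩ := (ht.isBlack_natCast h0 _).1 h1
    have hlt := ZMod.val_lt x
    have hxs : ((2 * s : ℕ) : ZMod (2 * (l + 1))) = x := by
      rw [two_mul s, ← hs, ZMod.natCast_zmod_val]
    refine hi ⟨⟨s, by omega⟩, β.injective (Subtype.ext ?_)⟩
    rw [hγ, ← hx]
    exact congrArg t hxs
  let σ : Equiv.Perm (Fin N) := (finRotate (l + 1)).viaFintypeEmbedding γ
  have hσ : ∀ s, (β (σ (γ s)) : Node m n) =
      t ((2 * s.val : ℕ) + 1 + 1 : ZMod (2 * (l + 1))) := by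
    intro s
    simp only [σ]
    rw [Equiv.Perm.viaFintypeEmbedding_apply_image, hγ, coe_finRotate]
    congr 1
    split_ifs with h
    · subst h
      have : ((2 * (l + 1) : ℕ) : ZMod (2 * (l + 1))) = 0 := ZMod.natCast_self _
      push_cast at this ⊢
      linear_combination -this
    · push_cast
      ring
  have hσ' : ∀ i, i ∉ Set.range γ → σ i = i := fun i hi =>
    Equiv.Perm.viaFintypeEmbedding_apply_notMem_range _ _ hi
  -- The orbit runs straight through the white node, so the next black node is rematched backwards
  -- along the same line.
  have hdir : ∀ s, matchDir M' (β (σ (γ s))) = (matchDir M (β (γ s))).opp := by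
    intro s
    have h1 : IsBlack (t ((2 * s.val : ℕ) + 1 + 1 : ZMod (2 * (l + 1)))) := by
      rw [← hσ]
      exact (β _).2
    rw [hσ, hγ, hM', ht.matchDir_symmDiff_black hM h1, add_sub_cancel_right, ← ht.next,
      hM.outDir_next (hb s), outDir_black (hb s)]
  have hnode : ∀ s, nbr (nbr (β (γ s) : Node m n) (matchDir M (β (γ s))))
      (matchDir M (β (γ s))) = β (σ (γ s)) := by
    intro s
    rw [hσ, hγ, ← ht.next, ← ht.next, hM.outDir_next (hb s), outDir_black (hb s)]
  have hpartner : ∀ i, partner M' (β (σ i)) = partner M (β i) := by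
    intro i
    by_cases hi : i ∈ Set.range γ
    · obtain ⟨s, rfl⟩ := hi
      rw [partner, hdir, ← hnode, nbr_nbr_opp, partner]
    · rw [hσ' i hi, partner, hM', ht.matchDir_symmDiff_of_notMem hM (hnot i hi), partner]
  have hterm : ∀ i, col (matchEdge M' (β (σ i))) + (matchDir M' (β (σ i))).negative =
      col (matchEdge M (β i)) + (matchDir M (β i)).negative +
        if i ∈ Set.range γ then 1 else 0 := by
    intro i
    by_cases hi : i ∈ Set.range γ
    · rw [if_pos hi]
      obtain ⟨s, rfl⟩ := hi
      rw [matchEdge, hdir, ← hnode, edgeAt_nbr_opp, col_edgeAt_nbr, Dir.negative_opp, matchEdge,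
        add_assoc]
    · rw [if_neg hi, add_zero, hσ' i hi, matchEdge, hM',
        ht.matchDir_symmDiff_of_notMem hM (hnot i hi), matchEdge]
  constructor
  · have h1 := neg_one_uzpow_sum_comp σ
      (fun i j => ltNode (partner M' (β i)) (partner M' (β j))) fun i j hij => by
        refine ltNode_swap fun h => hij (β.injective (Subtype.ext ?_))
        exact (ht.isPerfectMatching hM).partner_injective h
    have h2 : Equiv.Perm.sign σ = (-1 : ℤˣ) ^ (l : ZMod 2) := by
      rw [Equiv.Perm.viaFintypeEmbedding_sign, sign_finRotate, uzpow_natCast,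
        Nat.add_sub_cancel]
    simp only [hpartner] at h1
    rw [h2, ← uzpow_add] at h1
    exact neg_one_uzpow_injective h1
  · rw [edgeSum, ← Equiv.sum_comp σ]
    simp_rw [hterm]
    rw [Finset.sum_add_distrib, ← edgeSum, Finset.sum_boole]
    congr 1
    have : ({i | i ∈ Set.range γ} : Finset (Fin N)) = Finset.univ.map γ := by
      ext i
      simp
    rw [this, Finset.card_map, Finset.card_univ, Fintype.card_fin, Nat.cast_succ]

theorem IsOrbit.parity_symmDiff (ht : IsOrbit M k t) (hM : IsPerfectMatching M) :
    parity (symmDiff M (U (orbitArcs M t))) = parity M + 1 := by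
  classical
  obtain ⟨t', ht', h, h0⟩ := ht.exists_black
  rw [← h]
  obtain ⟨l', hl'⟩ := (ht'.even h0).two_dvd
  obtain ⟨l, rfl⟩ : ∃ l, l' = l + 1 := Nat.exists_eq_succ_of_ne_zero (by
    rintro rfl
    exact ht'.pos.ne' hl')
  subst hl'
  let β := (Fintype.equivFin (Black m n)).symm
  obtain ⟨c, hc⟩ := exists_inversions_eq β
  have h1 := hc M hM
  have h2 := hc _ (ht'.isPerfectMatching hM)
  obtain ⟨h3, h4⟩ := ht'.inversions_edgeSum_symmDiff hM h0 β
  unfold parity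
  grind

end Flip

/-! ### Types in terms of parities. -/

section Types

variable {m n : ℕ} [NeZero m] [NeZero n]

omit [NeZero m] [NeZero n] in
theorem ind_symmDiff (S T : Set (Edge m n)) (e : Edge m n) :
    ind (symmDiff S T) e = ind S e + ind T e := by
  by_cases hS : e ∈ S <;> by_cases hT : e ∈ T <;> simp [ind, Set.mem_symmDiff, hS, hT]
  rfl

omit [NeZero m] in
theorem parA_symmDiff (S T : Set (Edge m n)) : parA (symmDiff S T) = parA S + parA T := by
  simp only [parA, ind_symmDiff, Finset.sum_add_distrib]

omit [NeZero n] in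
theorem parB_symmDiff (S T : Set (Edge m n)) : parB (symmDiff S T) = parB S + parB T := by
  simp only [parB, ind_symmDiff, Finset.sum_add_distrib]

theorem ncard_inter_range {α β : Type*} [Fintype α] (S : Set β) {f : α → β}
    (hf : Function.Injective f) [DecidablePred fun a => f a ∈ S] :
    ((S ∩ Set.range f).ncard : ZMod 2) = ∑ a, if f a ∈ S then 1 else 0 := by
  rw [Finset.sum_boole, ← Set.image_preimage_eq_inter_range, Set.ncard_image_of_injective _ hf,
    ← Set.ncard_coe_finset]
  congr 2
  ext a
  simp

omit [NeZero m] in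
theorem ncard_inter_A (S : Set (Edge m n)) : ((S ∩ A m n).ncard : ZMod 2) = parA S := by
  classical
  have h : A m n = Set.range fun j => Edge.vert (-1, j) := by
    ext e
    simp [A, eq_comm]
  rw [h, ncard_inter_range S fun j j' h => by simpa using h, parA]
  simp only [ind]

omit [NeZero n] in
theorem ncard_inter_B (S : Set (Edge m n)) : ((S ∩ B m n).ncard : ZMod 2) = parB S := by
  classical
  have h : B m n = Set.range fun i => Edge.horiz (i, -1) := by
    ext e
    simp [B, eq_comm]
  rw [h, ncard_inter_range S fun j j' h => by simpa using h, parB]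
  simp only [ind]

theorem typeEE_iff (S : Set (Edge m n)) : TypeEE S ↔ parA S = 0 ∧ parB S = 0 := by
  rw [TypeEE, ← ZMod.natCast_eq_zero_iff_even, ← ZMod.natCast_eq_zero_iff_even, ncard_inter_A,
    ncard_inter_B]

theorem typeEO_iff (S : Set (Edge m n)) : TypeEO S ↔ parA S = 0 ∧ parB S = 1 := by
  rw [TypeEO, ← ZMod.natCast_eq_zero_iff_even, ← ZMod.natCast_eq_one_iff_odd, ncard_inter_A,
    ncard_inter_B]

theorem typeOE_iff (S : Set (Edge m n)) : TypeOE S ↔ parA S = 1 ∧ parB S = 0 := by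
  rw [TypeOE, ← ZMod.natCast_eq_zero_iff_even, ← ZMod.natCast_eq_one_iff_odd, ncard_inter_A,
    ncard_inter_B]

theorem typeOO_iff (S : Set (Edge m n)) : TypeOO S ↔ parA S = 1 ∧ parB S = 1 := by
  rw [TypeOO, ← ZMod.natCast_eq_one_iff_odd, ← ZMod.natCast_eq_one_iff_odd, ncard_inter_A,
    ncard_inter_B]

theorem typeEE_iff_parity (S : Set (Edge m n)) : TypeEE S ↔ parity S = 0 := by
  rw [typeEE_iff, parity]
  generalize parA S = a
  generalize parB S = b
  revert a b
  decide

theorem not_typeEE_iff_parity (S : Set (Edge m n)) :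
    TypeEO S ∨ TypeOE S ∨ TypeOO S ↔ parity S = 1 := by
  rw [typeEO_iff, typeOE_iff, typeOO_iff, parity]
  generalize parA S = a
  generalize parB S = b
  revert a b
  decide

end Types

/-! ### The effect of `Phi` on types. -/

section Main

variable {m n : ℕ} [Nontrivial (ZMod m)] [Nontrivial (ZMod n)] [NeZero m] [NeZero n]
  [Fact (Even m)] [Fact (Even n)] {M : Set (Edge m n)}
  (r : Set (Node m n) → Set (Node m n) → Prop) [IsLinearOrder (Set (Node m n)) r]

theorem IsPerfectMatching.parity_phi (hM : IsPerfectMatching M) :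
    parity (Phi r M) = parity M + 1 := by
  obtain ⟨k, t, ht, h⟩ := hM.exists_orbit_firstDicycle r
  rw [Phi, h, ht.parity_symmDiff hM]

/-- The flipped matching has type `EE`, so on each layer the parities of `M` and of the dicycle sum
to zero. -/
theorem IsPerfectMatching.par_firstDicycle (hM : IsPerfectMatching M) (h : parity M = 1) :
    parA (U (firstDicycle r M)) = parA M ∧ parB (U (firstDicycle r M)) = parB M := by
  have h1 : parity (Phi r M) = 0 := by rw [hM.parity_phi r, h]; rfl
  rw [← typeEE_iff_parity, typeEE_iff, Phi, parA_symmDiff, parB_symmDiff] at h1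
  constructor <;> grind

end Main

end TorusGrid

theorem mainTheorem3 (m n : ℕ) (hm : 0 < m) (hn : 0 < n) (hm_even : Even m) (hn_even : Even n)
    (r : Set (TorusGrid.Node m n) → Set (TorusGrid.Node m n) → Prop)
    (hr : IsLinearOrder (Set (TorusGrid.Node m n)) r) :
    (∀ M : Set (TorusGrid.Edge m n), TorusGrid.IsPerfectMatching M →
      TorusGrid.IsFirstDicycle r M (TorusGrid.firstDicycle r M) ∧
      (∀ C, TorusGrid.IsFirstDicycle r M C → C = TorusGrid.firstDicycle r M) ∧
      TorusGrid.IsPerfectMatching (TorusGrid.Phi r M)) ∧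
    (∀ M : Set (TorusGrid.Edge m n), TorusGrid.IsPerfectMatching M →
      (TorusGrid.TypeEO M → TorusGrid.TypeEO (TorusGrid.U (TorusGrid.firstDicycle r M))) ∧
      (TorusGrid.TypeOE M → TorusGrid.TypeOE (TorusGrid.U (TorusGrid.firstDicycle r M))) ∧
      (TorusGrid.TypeOO M → TorusGrid.TypeOO (TorusGrid.U (TorusGrid.firstDicycle r M)))) ∧
    TorusGrid.Phi r '' {M | TorusGrid.IsPerfectMatching M ∧
        (TorusGrid.TypeEO M ∨ TorusGrid.TypeOE M ∨ TorusGrid.TypeOO M)} =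
      {M | TorusGrid.IsPerfectMatching M ∧ TorusGrid.TypeEE M} := by
  have : NeZero m := ⟨hm.ne'⟩
  have : NeZero n := ⟨hn.ne'⟩
  have : Fact (Even m) := ⟨hm_even⟩
  have : Fact (Even n) := ⟨hn_even⟩
  have : Nontrivial (ZMod m) := ZMod.nontrivial_iff.2 (by
    rintro rfl
    exact absurd hm_even (by decide))
  have : Nontrivial (ZMod n) := ZMod.nontrivial_iff.2 (by
    rintro rfl
    exact absurd hn_even (by decide))
  refine ⟨fun M hM => ⟨hM.isFirstDicycle r,
    fun C hC => hM.firstDicycle_unique r hC (hM.isFirstDicycle r), hM.phi r⟩,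
    fun M hM => ⟨fun h => ?_, fun h => ?_, fun h => ?_⟩, ?_⟩
  · have h1 := hM.par_firstDicycle r ((TorusGrid.not_typeEE_iff_parity M).1 (Or.inl h))
    rwa [TorusGrid.typeEO_iff, h1.1, h1.2, ← TorusGrid.typeEO_iff]
  · have h1 := hM.par_firstDicycle r ((TorusGrid.not_typeEE_iff_parity M).1 (Or.inr (Or.inl h)))
    rwa [TorusGrid.typeOE_iff, h1.1, h1.2, ← TorusGrid.typeOE_iff]
  · have h1 := hM.par_firstDicycle r ((TorusGrid.not_typeEE_iff_parity M).1 (Or.inr (Or.inr h)))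
    rwa [TorusGrid.typeOO_iff, h1.1, h1.2, ← TorusGrid.typeOO_iff]
  · ext M
    simp only [Set.mem_image, Set.mem_ofPred_eq, TorusGrid.not_typeEE_iff_parity,
      TorusGrid.typeEE_iff_parity]
    constructor
    · rintro ⟨M, ⟨hM, h⟩, rfl⟩
      refine ⟨hM.phi r, ?_⟩
      rw [hM.parity_phi r, h]
      rfl
    · rintro ⟨hM, h⟩
      exact ⟨TorusGrid.Phi r M, ⟨hM.phi r, by rw [hM.parity_phi r, h, zero_add]⟩, hM.phi_phi r⟩
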